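/- Let $R$ be an associative ring with unit, $\mathsf{Mod}(R)$ the category of right $R$-modules, and $\mathsf{mod}(R^{op})$ the category of finitely presented left $R$-modules. Let $\mathsf{fp}(\mathsf{Mod}(R),\mathsf{Ab})$ be the (abelian) category of finitely presented functors, i.e. of those $F\colon\mathsf{Mod}(R)\to\mathsf{Ab}$ for which there is an exact sequence $(Y,-)\to(X,-)\to F\to 0$ with $X,Y\in\mathsf{Mod}(R)$, and let $(\mathsf{mod}(R^{op}),\mathsf{Ab})$ be the category of additive functors. Let $w\colon\mathsf{fp}(\mathsf{Mod}(R),\mathsf{Ab})\to\mathsf{Mod}(R)$ be the contravariant functor adjoint to the Yoneda embedding, so that $\mathsf{Nat}(F,(X,-))\cong\mathrm{Hom}_R(X,w(F))$ naturally in $F$ and $X$, and let $t\colon\mathsf{Mod}(R)\to(\mathsf{mod}(R^{op}),\mathsf{Ab})$ be the functor $t(M)=M\otimes_R-$. Define two contravariant functors $$\mathsf{D}_A=R_0(t\circ w)\colon\mathsf{fp}(\mathsf{Mod}(R),\mathsf{Ab})\to(\mathsf{mod}(R^{op}),\mathsf{Ab}),$$ the zeroth right derived functor of the contravariant functor $t\circ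 w$ (computed with projective resolutions in $\mathsf{fp}(\mathsf{Mod}(R),\mathsf{Ab})$), and $$\mathsf{D}_R\colon(\mathsf{mod}(R^{op}),\mathsf{Ab})\to\mathsf{fp}(\mathsf{Mod}(R),\mathsf{Ab}),\qquad(\mathsf{D}_R G)(M)=\mathsf{Nat}(G,M\otimes_R-).$$ Then $\mathsf{D}_A\colon\mathsf{fp}(\mathsf{Mod}(R),\mathsf{Ab})\to(\mathsf{mod}(R^{op}),\mathsf{Ab})^{op}$ is left adjoint to $\mathsf{D}_R\colon(\mathsf{mod}(R^{op}),\mathsf{Ab})^{op}\to\mathsf{fp}(\mathsf{Mod}(R),\mathsf{Ab})$. Moreover, let any such adjunction be given, let $\delta\colon 1\to\mathsf{D}_R\mathsf{D}_A$ be its unit, and put $F_q=\ker(\delta_F)$. Let $\ker(\mathsf{D}_A)$ be the full subcategory of $\mathsf{fp}(\mathsf{Mod}(R),\mathsf{Ab})$ of all $F$ with $\mathsf{D}_A F\cong 0$. Then $\mathsf{D}_A(F_q)\cong 0$ for every $F$, and the functor $F\mapsto F_q$ from $\mathsf{fp}(\mathsf{Mod}(R),\mathsf{Ab})$ to $\ker(\mathsf{D}_A)$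 is right adjoint to the inclusion $\ker(\mathsf{D}_A)\to\mathsf{fp}(\mathsf{Mod}(R),\mathsf{Ab})$. -/

import Mathlib

open CategoryTheory CategoryTheory.Limits Opposite
open scoped ZeroObject
set_option linter.unusedSectionVars false
universe u v

namespace AGJ
lemma map_comp_app {C : Type*} [Category C] (F : C ⥤ AddCommGrpCat.{u}) {X Y Z : C}
    (f : X ⟶ Y) (g : Y ⟶ Z) (x : F.obj X) : F.map (f ≫ g) x = F.map g (F.map f x) :=
  ConcreteCategory.congr_hom (F.map_comp f g) x

lemma nat_app {C : Type*} [Category C] {F G : C ⥤ AddCommGrpCat.{u}} (a : F ⟶ G) {X Y : C}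
    (f : X ⟶ Y) (x : F.obj X) : a.app Y (F.map f x) = G.map f (a.app X x) :=
  ConcreteCategory.congr_hom (a.naturality f) x

section
variable {C : Type v} [Category.{u} C] [Abelian C]

/-- The representable functor `(X, -) : C ⥤ Ab`. -/
abbrev repFunctor (X : C) : C ⥤ AddCommGrpCat.{u} := preadditiveCoyoneda.obj (op X)

variable (C) in
/-- Finitely presented functors `F : C ⥤ Ab`: there is a sequence `(Y, -) ⟶ (X, -) ⟶ F ⟶ 0`
which is exact at every object. Such an `F` is additive, see `IsFinPres.additive`.
The category `fp(C, Ab)` is the full subcategory `(IsFinPres C).FullSubcategory`. -/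
def IsFinPres : ObjectProperty (C ⥤ AddCommGrpCat.{u}) := fun F =>
  ∃ (X Y : C) (a : repFunctor Y ⟶ repFunctor X) (p : repFunctor X ⟶ F), ∀ A : C,
    Function.Exact (a.app A) (p.app A) ∧ Function.Surjective (p.app A)

/-- The Yoneda lemma: the natural transformation `(X, -) ⟶ F` of an element of `F X`. -/
def ofElt (F : C ⥤ AddCommGrpCat.{u}) [F.Additive] {X : C} (x : F.obj X) : repFunctor X ⟶ F where
  app A := AddCommGrpCat.ofHom
    { toFun := fun g : X ⟶ A => F.map g x
      map_zero' := by change F.map (0 : X ⟶ A) x = 0; simp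
      map_add' := fun (g h : X ⟶ A) => by
        change F.map (g + h) x = F.map g x + F.map h x
        simp }
  naturality A B h := by ext (g : X ⟶ A); exact ConcreteCategory.congr_hom (F.map_comp g h) x

lemma ofElt_app (F : C ⥤ AddCommGrpCat.{u}) [F.Additive] {X : C} (x : F.obj X) (A : C) (g : X ⟶ A) :
    (ofElt F x).app A g = F.map g x := rfl

lemma app_eq {F : C ⥤ AddCommGrpCat.{u}} {X A : C} (p : repFunctor X ⟶ F) (g : X ⟶ A) :
    p.app A g = F.map g (p.app X (𝟙 X)) := by
  have := ConcreteCategory.congr_hom (p.naturality g) (𝟙 X)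
  refine Eq.trans ?_ this
  change p.app A g = p.app A (𝟙 X ≫ g)
  rw [Category.id_comp]

lemma IsFinPres.additive {F : C ⥤ AddCommGrpCat.{u}} (h : IsFinPres C F) : F.Additive := by
  obtain ⟨X, Y, a, p, h⟩ := h
  refine ⟨fun {A B f g} => ?_⟩
  ext s
  obtain ⟨t, rfl⟩ := (h A).2 s
  have e : ∀ k : A ⟶ B, F.map k (p.app A t) = p.app B ((repFunctor X).map k t) := fun k =>
    (ConcreteCategory.congr_hom (p.naturality k) t).symm
  change F.map (f + g) (p.app A t) = F.map f (p.app A t) + F.map g (p.app A t)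
  rw [e, e, e, ← map_add, (repFunctor X).map_add]
  rfl

lemma isFinPres_iff (F : C ⥤ AddCommGrpCat.{u}) [F.Additive] : IsFinPres C F ↔
    ∃ (X Y : C) (f : X ⟶ Y) (x : F.obj X), (∀ A (s : F.obj A), ∃ g : X ⟶ A, F.map g x = s) ∧
      ∀ A (g : X ⟶ A), F.map g x = 0 ↔ ∃ h : Y ⟶ A, f ≫ h = g := by
  constructor
  · rintro ⟨X, Y, a, p, h⟩
    refine ⟨X, Y, a.app Y (𝟙 Y), p.app X (𝟙 X), fun A s => ?_, fun A g => ?_⟩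
    · obtain ⟨g, hg⟩ := (h A).2 s
      exact ⟨g, (app_eq p g).symm.trans hg⟩
    · rw [← app_eq p g]
      refine ((h A).1 g).trans ?_
      refine exists_congr fun k => ?_
      rw [app_eq a k]
      rfl
  · rintro ⟨X, Y, f, x, h1, h2⟩
    exact ⟨X, Y, preadditiveCoyoneda.map f.op, ofElt F x, fun A => ⟨fun g => h2 A g, fun s => h1 A s⟩⟩

lemma IsFinPres.of_coker {F G H : C ⥤ AddCommGrpCat.{u}} (hF : IsFinPres C F) (hG : IsFinPres C G)
    (a : F ⟶ G) (p : G ⟶ H) (h : ∀ A, Function.Exact (a.app A) (p.app A))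
    (h' : ∀ A, Function.Surjective (p.app A)) [H.Additive] : IsFinPres C H := by
  have := hF.additive
  have := hG.additive
  obtain ⟨X, Y, f, x, h1, h2⟩ := (isFinPres_iff F).1 hF
  obtain ⟨X', Y', f', x', h1', h2'⟩ := (isFinPres_iff G).1 hG
  obtain ⟨c, hc⟩ := h1' X (a.app X x)
  refine (isFinPres_iff H).2 ⟨X', Y' ⊞ X, biprod.lift f' c, p.app X' x', fun A s => ?_, fun A g => ?_⟩
  · obtain ⟨s, rfl⟩ := h' A s
    obtain ⟨g, rfl⟩ := h1' A s
    exact ⟨g, (nat_app p g x').symm⟩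
  · rw [← nat_app, h A]
    constructor
    · rintro ⟨s, hs⟩
      obtain ⟨k, rfl⟩ := h1 A s
      rw [nat_app, ← hc, ← map_comp_app, eq_comm, ← sub_eq_zero] at hs
      have hs' : G.map (g - c ≫ k) x' = 0 := by simpa using hs
      obtain ⟨l, hl⟩ := (h2' _ _).1 hs'
      exact ⟨biprod.desc l k, by simp [hl]⟩
    · rintro ⟨k, rfl⟩
      refine ⟨F.map (biprod.inr ≫ k) x, ?_⟩
      rw [nat_app, ← hc, ← map_comp_app, eq_comm, ← sub_eq_zero]
      have : G.map (biprod.lift f' c ≫ k - c ≫ biprod.inr ≫ k) x' = 0 := by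
        refine (h2' _ _).2 ⟨biprod.inl ≫ k, ?_⟩
        rw [biprod.lift_eq]; simp
      simpa using this

lemma IsFinPres.of_ker {K F G : C ⥤ AddCommGrpCat.{u}} (hF : IsFinPres C F) (hG : IsFinPres C G)
    (i : K ⟶ F) (a : F ⟶ G) (h : ∀ A, Function.Exact (i.app A) (a.app A))
    (h' : ∀ A, Function.Injective (i.app A)) [K.Additive] : IsFinPres C K := by
  have := hF.additive
  have := hG.additive
  obtain ⟨X, Y, f, x, h1, h2⟩ := (isFinPres_iff F).1 hF
  obtain ⟨X', Y', f', x', h1', h2'⟩ := (isFinPres_iff G).1 hG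
  obtain ⟨c, hc⟩ := h1' X (a.app X x)
  have h0 : a.app (pushout c f') (F.map (pushout.inl c f') x) = 0 := by
    rw [nat_app, ← hc, ← map_comp_app]
    exact (h2' _ _).2 ⟨pushout.inr c f', pushout.condition.symm⟩
  obtain ⟨k, hk⟩ := (h _ _).1 h0
  refine (isFinPres_iff K).2 ⟨pushout c f', pushout (pushout.inl c f') f, pushout.inl _ _, k,
    fun A s => ?_, fun A g => ?_⟩
  · obtain ⟨g, hg⟩ := h1 A (i.app A s)
    have : a.app A (F.map g x) = 0 := (h _ _).2 ⟨s, hg.symm⟩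
    rw [nat_app, ← hc, ← map_comp_app] at this
    obtain ⟨l, hl⟩ := (h2' _ _).1 this
    refine ⟨pushout.desc g l hl.symm, h' A ?_⟩
    rw [nat_app, hk, ← map_comp_app, pushout.inl_desc, hg]
  · rw [← (injective_iff_map_eq_zero' (i.app A).hom).1 (h' A)]
    change i.app A (K.map g k) = 0 ↔ _
    rw [nat_app, hk, ← map_comp_app, h2]
    constructor
    · rintro ⟨l, hl⟩
      exact ⟨pushout.desc g l hl.symm, pushout.inl_desc _ _ _⟩
    · rintro ⟨l, rfl⟩
      exact ⟨pushout.inr _ _ ≫ l, by rw [pushout.condition_assoc]⟩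

/-- A functor which is pointwise a product of finitely presented functors is finitely presented. -/
lemma IsFinPres.of_product {J : Type u} [HasCoproductsOfShape J C] {F : J → C ⥤ AddCommGrpCat.{u}}
    (hF : ∀ j, IsFinPres C (F j)) {P : C ⥤ AddCommGrpCat.{u}} (π : ∀ j, P ⟶ F j)
    (ext : ∀ A (s t : P.obj A), (∀ j, (π j).app A s = (π j).app A t) → s = t)
    (ex : ∀ A (s : ∀ j, (F j).obj A), ∃ t : P.obj A, ∀ j, (π j).app A t = s j) :
    IsFinPres C P := by
  have hadd : ∀ j, (F j).Additive := fun j => (hF j).additive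
  have : P.Additive := ⟨fun {A B f g} => by
    ext s
    refine ext _ _ _ fun j => ?_
    change (π j).app B (P.map (f + g) s) = (π j).app B (P.map f s + P.map g s)
    rw [map_add, nat_app, nat_app, nat_app, (F j).map_add]
    rfl⟩
  choose X Y f x h1 h2 using fun j => (isFinPres_iff (F j)).1 (hF j)
  obtain ⟨t, ht⟩ := ex (∐ X) (fun j => (F j).map (Sigma.ι X j) (x j))
  refine (isFinPres_iff _).2 ⟨∐ X, ∐ Y, Limits.Sigma.map f, t, fun A s => ?_, fun A g => ?_⟩
  · choose g hg using fun j => h1 j A ((π j).app A s)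
    refine ⟨Sigma.desc g, ext _ _ _ fun j => ?_⟩
    rw [nat_app, ht, ← map_comp_app, Sigma.ι_desc, hg]
  · have : P.map g t = 0 ↔ ∀ j, (F j).map (Sigma.ι X j ≫ g) (x j) = 0 := by
      constructor
      · intro h j
        rw [map_comp_app, ← ht, ← nat_app, h, map_zero]
      · intro h
        refine ext _ _ _ fun j => ?_
        rw [map_zero, nat_app, ht, ← map_comp_app, h]
    rw [this]
    constructor
    · intro h
      choose k hk using fun j => (h2 j _ _).1 (h j)
      exact ⟨Sigma.desc k, by ext j; simp [hk]⟩
    · rintro ⟨k, rfl⟩ j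
      exact (h2 j _ _).2 ⟨Sigma.ι Y j ≫ k, by simp⟩

lemma IsFinPres.of_isLimit {J : Type u} [HasCoproductsOfShape J C]
    {F : Discrete J ⥤ C ⥤ AddCommGrpCat.{u}}
    (hF : ∀ j, IsFinPres C (F.obj j)) (c : Cone F) (hc : IsLimit c) : IsFinPres C c.pt := by
  have hc' : ∀ A, Nonempty (IsLimit (((evaluation C AddCommGrpCat.{u}).obj A ⋙ forget _).mapCone c)) :=
    fun A => ⟨isLimitOfPreserves _ hc⟩
  refine IsFinPres.of_product (fun j => hF ⟨j⟩) (fun j => c.π.app ⟨j⟩) (fun A s t hst => ?_) (fun A s => ?_)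
  · obtain ⟨l⟩ := hc' A
    exact Types.isLimitEquivSections l |>.injective (by ext ⟨j⟩; exact hst j)
  · obtain ⟨l⟩ := hc' A
    refine ⟨(Types.isLimitEquivSections l).symm ⟨fun j => s j.as, ?_⟩, fun j => ?_⟩
    · rintro ⟨i⟩ ⟨j⟩ h
      obtain rfl := Discrete.eq_of_hom h
      obtain rfl : h = 𝟙 _ := rfl
      simp
    · exact Types.isLimitEquivSections_symm_apply l _ _

lemma isFinPres_repFunctor (X : C) : IsFinPres C (repFunctor X) := by
  refine (isFinPres_iff _).2 ⟨X, 0, 0, 𝟙 X, fun A s => ⟨s, Category.id_comp _⟩, fun A g => ?_⟩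
  change 𝟙 X ≫ g = 0 ↔ _
  simp [eq_comm]

lemma exact_app {F G H : C ⥤ AddCommGrpCat.{u}} {f : F ⟶ G} {g : G ⟶ H} (w : f ≫ g = 0)
    (h : (ShortComplex.mk f g w).Exact) (A : C) : Function.Exact (f.app A) (g.app A) := by
  have := h.map ((evaluation C AddCommGrpCat.{u}).obj A)
  exact (ShortComplex.ab_exact_iff_function_exact _).1 this

lemma surj_app {F G : C ⥤ AddCommGrpCat.{u}} (f : F ⟶ G) [Epi f] (A : C) :
    Function.Surjective (f.app A) := by
  exact (AddCommGrpCat.epi_iff_surjective (f.app A)).1 inferInstance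

lemma inj_app {F G : C ⥤ AddCommGrpCat.{u}} (f : F ⟶ G) [Mono f] (A : C) :
    Function.Injective (f.app A) := by
  exact (AddCommGrpCat.mono_iff_injective (f.app A)).1 inferInstance

lemma additive_of_mono {C D : Type*} [Category C] [Category D] [Preadditive C] [Abelian D]
    {F G : C ⥤ D} (i : F ⟶ G) [Mono i]
    [G.Additive] : F.Additive := ⟨fun {A B f g} => by
  rw [← cancel_mono (i.app B)]
  simp⟩

lemma additive_of_epi {C D : Type*} [Category C] [Category D] [Preadditive C] [Abelian D]
    {F G : C ⥤ D} (i : F ⟶ G) [Epi i]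
    [F.Additive] : G.Additive := ⟨fun {A B f g} => by
  rw [← cancel_epi (i.app A)]
  simp [← NatTrans.naturality]⟩

instance : (IsFinPres C).IsClosedUnderKernels := ⟨by
  rintro _ ⟨f, k, hk, hF, hG⟩
  have := hF.additive
  have : Mono k.ι := Fork.IsLimit.mono hk
  have := additive_of_mono k.ι
  exact .of_ker hF hG k.ι f (exact_app (by simp) (ShortComplex.exact_of_f_is_kernel (.mk k.ι f k.condition) 
    (IsLimit.ofIsoLimit hk (Fork.ext (Iso.refl _))))) (inj_app _)⟩

instance : (IsFinPres C).IsClosedUnderCokernels := ⟨by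
  rintro _ ⟨f, k, hk, hF, hG⟩
  have := hG.additive
  have : Epi k.π := Cofork.IsColimit.epi hk
  have := additive_of_epi k.π
  exact .of_coker hF hG f k.π (exact_app (by simp) (ShortComplex.exact_of_g_is_cokernel (.mk f k.π k.condition) 
    (IsColimit.ofIsoColimit hk (Cofork.ext (Iso.refl _))))) (surj_app _)⟩

instance : (IsFinPres C).IsClosedUnderIsomorphisms := ⟨by
  rintro F G e ⟨X, Y, a, p, h⟩
  refine ⟨X, Y, a, p ≫ e.hom, fun A => ⟨fun g => ?_, ?_⟩⟩
  · rw [← (h A).1 g]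
    exact (injective_iff_map_eq_zero' (e.hom.app A).hom).1 (inj_app e.hom A) _
  · exact (surj_app e.hom A).comp (h A).2⟩

instance : (IsFinPres C).IsClosedUnderFiniteProducts :=
  .of_isClosedUnderLimitsOfShape.{u} fun J _ =>  ⟨by
    rintro X ⟨p⟩
    have : HasCoproductsOfShape J C := hasColimitsOfShape_discrete C J
    exact IsFinPres.of_isLimit p.prop_diag_obj _ p.isLimit⟩

instance : (IsFinPres C).ContainsZero := ⟨⟨repFunctor (0 : C), Functor.isZero _ fun A =>
  have : Subsingleton ((repFunctor (0 : C)).obj A) := ⟨fun f g => (isZero_zero C).eq_of_src f g⟩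
  AddCommGrpCat.isZero_of_subsingleton _, isFinPres_repFunctor 0⟩⟩

/-- The category `fp(C, Ab)` is abelian. -/
noncomputable instance : Abelian (IsFinPres C).FullSubcategory := inferInstance

instance : (IsFinPres C).ι.PreservesEpimorphisms :=
  ObjectProperty.preservesEpimorphisms_ι_of_isNormalMonoCategory _

instance : (IsFinPres C).ι.PreservesMonomorphisms :=
  ObjectProperty.preservesMonomorphisms_ι_of_isNormalEpiCategory _

variable (C) in
/-- The Yoneda embedding `X ↦ (X, -)`, from `Cᵒᵖ` to `fp(C, Ab)`. -/
noncomputable def yonedaFP : Cᵒᵖ ⥤ (IsFinPres C).FullSubcategory :=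
  (IsFinPres C).lift preadditiveCoyoneda fun X => isFinPres_repFunctor X.unop

instance (X : Cᵒᵖ) : Projective ((yonedaFP C).obj X) := ⟨by
  intro E G f e he
  have : Epi e.hom := inferInstanceAs (Epi ((IsFinPres C).ι.map e))
  have := E.property.additive
  obtain ⟨s, hs⟩ := surj_app e.hom X.unop (f.hom.app X.unop (𝟙 X.unop))
  refine ⟨ObjectProperty.homMk (ofElt E.obj s), ?_⟩
  ext A (g : X.unop ⟶ A)
  change e.hom.app A (E.obj.map g s) = f.hom.app A g
  rw [nat_app, hs]
  exact (app_eq (X := X.unop) f.hom g).symm⟩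

instance : EnoughProjectives (IsFinPres C).FullSubcategory := ⟨by
  intro F
  have := F.property.additive
  obtain ⟨X, Z, f, x, h1, h2⟩ := (isFinPres_iff F.obj).1 F.property
  have : Epi (ofElt F.obj x) := by
    have : ∀ A, Epi ((ofElt F.obj x).app A) := fun A =>
      (AddCommGrpCat.epi_iff_surjective _).2 (h1 A)
    exact NatTrans.epi_of_epi_app _
  have : Epi (ObjectProperty.homMk (ofElt F.obj x) : (yonedaFP C).obj (op X) ⟶ F) :=
    Functor.epi_of_epi_map (IsFinPres C).ι this
  exact ⟨{ p := (yonedaFP C).obj (op X), f := ObjectProperty.homMk (ofElt F.obj x) }⟩⟩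

instance : (yonedaFP C).IsRightAdjoint := by
  refine Functor.isRightAdjoint_of_leftAdjointObjIsDefined_eq_top ?_
  ext F
  simp only [Pi.top_apply, Prop.top_eq_true, iff_true]
  have := F.property.additive
  obtain ⟨X, Z, f, x, h1, h2⟩ := (isFinPres_iff F.obj).1 F.property
  have hx : F.obj.map f x = 0 := (h2 Z f).2 ⟨𝟙 Z, Category.comp_id f⟩
  let ev (T : Cᵒᵖ) (α : F ⟶ (yonedaFP C).obj T) : T.unop ⟶ X := α.hom.app X x
  have hev (T : Cᵒᵖ) (α : F ⟶ (yonedaFP C).obj T) (A : C) (g : X ⟶ A) :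
      α.hom.app A (F.obj.map g x) = ev T α ≫ g := nat_app α.hom g x
  have hev0 (T : Cᵒᵖ) (α : F ⟶ (yonedaFP C).obj T) : ev T α ≫ f = 0 := by
    rw [← hev, hx, map_zero]; rfl
  let ψ (T : Cᵒᵖ) (α : F ⟶ (yonedaFP C).obj T) : op (kernel f) ⟶ T :=
    (kernel.lift f (ev T α) (hev0 T α)).op
  have hψ (T : Cᵒᵖ) : Function.Bijective (ψ T) := by
    constructor
    · intro α β h
      have h' : ev T α = ev T β := by
        have := congr(Quiver.Hom.unop $h ≫ kernel.ι f)
        simpa [ψ] using this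
      ext A s
      obtain ⟨g, rfl⟩ := h1 A s
      rw [hev, hev, h']
    · intro γ
      let g : T.unop ⟶ X := γ.unop ≫ kernel.ι f
      have hg : g ≫ f = 0 := by simp [g]
      have wd (A : C) (k k' : X ⟶ A) (h : F.obj.map k x = F.obj.map k' x) : g ≫ k = g ≫ k' := by
        have : F.obj.map (k - k') x = 0 := by
          rw [F.obj.map_sub, ← sub_eq_zero.2 h]; rfl
        obtain ⟨l, hl⟩ := (h2 _ _).1 this
        rw [← sub_eq_zero, ← Preadditive.comp_sub, ← hl, reassoc_of% hg, zero_comp]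
      choose c hc using h1
      let α : F.obj ⟶ repFunctor T.unop :=
        { app A := AddCommGrpCat.ofHom
            { toFun s := g ≫ c A s
              map_zero' := by
                rw [wd A (c A 0) 0 (by rw [hc, F.obj.map_zero]; rfl), comp_zero]; rfl
              map_add' s t := by
                have : g ≫ c A (s + t) = g ≫ (c A s + c A t) :=
                  wd A _ _ (by rw [hc, F.obj.map_add]; change _ = F.obj.map _ x + F.obj.map _ x; rw [hc, hc])
                rw [this, Preadditive.comp_add]; rfl }
          naturality A B k := by
            ext s
            change g ≫ c B (F.obj.map k s) = (g ≫ c A s) ≫ k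
            exact (wd B (c B (F.obj.map k s)) (c A s ≫ k)
              (by rw [hc, map_comp_app, hc])).trans (Category.assoc _ _ _).symm }
      refine ⟨ObjectProperty.homMk α, Quiver.Hom.unop_inj ?_⟩
      change kernel.lift f (g ≫ c X x) _ = γ.unop
      rw [← cancel_mono (kernel.ι f), kernel.lift_ι]
      rw [wd X (c X x) (𝟙 X) (by rw [hc]; simp), Category.comp_id]
  refine Functor.CorepresentableBy.isCorepresentable (X := op (kernel f))
    ⟨fun {T} => (Equiv.ofBijective _ (hψ T)).symm, fun {T T'} g α => ?_⟩
  have key (β : F ⟶ (yonedaFP C).obj T) : ψ T' (β ≫ (yonedaFP C).map g) = ψ T β ≫ g := by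
    refine Quiver.Hom.unop_inj ?_
    change kernel.lift f (ev T' (β ≫ (yonedaFP C).map g)) _ = g.unop ≫ kernel.lift f (ev T β) _
    rw [← cancel_mono (kernel.ι f), Category.assoc, kernel.lift_ι, kernel.lift_ι]
    rfl
  refine (hψ T').1 ?_
  refine Eq.trans ?_ (key _).symm
  exact ((Equiv.ofBijective _ (hψ T')).apply_symm_apply _).trans
    congr($((Equiv.ofBijective _ (hψ T)).apply_symm_apply α) ≫ g).symm

variable (C) in
/-- The functor `w : fp(C, Ab) ⥤ Cᵒᵖ`, the left adjoint of the Yoneda embedding: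
`Nat(F, (X, -)) ≅ (X, w F)`. -/
noncomputable def wFunctor : (IsFinPres C).FullSubcategory ⥤ Cᵒᵖ := (yonedaFP C).leftAdjoint

instance : (preadditiveCoyoneda : Cᵒᵖ ⥤ C ⥤ AddCommGrpCat.{u}).Additive := ⟨by
  intro X Z f g
  ext A (k : X.unop ⟶ A)
  change (f.unop + g.unop) ≫ k = f.unop ≫ k + g.unop ≫ k
  rw [Preadditive.add_comp]⟩

instance : (yonedaFP C).Additive := inferInstanceAs ((IsFinPres C).lift _ _).Additive
instance : (wFunctor C).Additive := (Adjunction.ofIsRightAdjoint (yonedaFP C)).left_adjoint_additive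

noncomputable instance : HasInjectiveResolutions (IsFinPres C).FullSubcategoryᵒᵖ := inferInstance

end
section
variable {C D : Type*} [Category C] [Category D] [Preadditive C] [Abelian D]

instance : (additiveFunctor C D).IsClosedUnderSubobjects :=
  ⟨fun f _ h => by have : Functor.Additive _ := h; exact additive_of_mono f⟩

instance : (additiveFunctor C D).IsClosedUnderQuotients :=
  ⟨fun f _ h => by have : Functor.Additive _ := h; exact additive_of_epi f⟩

instance : (additiveFunctor C D).ContainsZero :=
  ⟨⟨0, isZero_zero _, (inferInstance : Functor.Additive (0 : C ⥤ D))⟩⟩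

instance : (additiveFunctor C D).IsClosedUnderFiniteProducts := ⟨fun J _ => ⟨by
  rintro X ⟨p⟩
  refine ⟨fun {A B f g} => ?_⟩
  have l := isLimitOfPreserves ((evaluation C D).obj B) p.isLimit
  refine l.hom_ext fun j => ?_
  have : (p.diag.obj j).Additive := p.prop_diag_obj j
  have n (h : A ⟶ B) : X.map h ≫ (p.π.app j).app B = (p.π.app j).app A ≫ (p.diag.obj j).map h :=
    (p.π.app j).naturality h
  change X.map (f + g) ≫ (p.π.app j).app B = (X.map f + X.map g) ≫ (p.π.app j).app B
  rw [Preadditive.add_comp]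
  rw [n, n, n, Functor.map_add, Preadditive.comp_add]⟩⟩

noncomputable instance : Abelian (C ⥤+ D) :=
  inferInstanceAs (Abelian (additiveFunctor C D).FullSubcategory)

end

section
variable (R : Type u) [Ring R]

open scoped TensorProduct

/-- Finite presentation, as a property of left `R`-modules. -/
def isFPMod : ObjectProperty (ModuleCat.{u} R) := fun L => Module.FinitePresentation R L

/-- The category of finitely presented left `R`-modules, i.e. `mod(Rᵒᵖ)` when `mod` refers to
right modules. -/
abbrev FPMod := (isFPMod R).FullSubcategory

instance : EssentiallySmall.{u} (FPMod R) :=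
  have h : isFPMod R ≤ ModuleCat.isFG.{u} R := fun L (_ : Module.FinitePresentation R L) =>
    (inferInstance : Module.Finite R L)
  essentiallySmall_of_fully_faithful (ObjectProperty.ιOfLE h)

/-- The category `(mod(Rᵒᵖ), Ab)` of additive functors on finitely presented left modules. -/
abbrev FPModAb := FPMod R ⥤+ AddCommGrpCat.{u}

instance : LocallySmall.{u} (FPModAb R) :=
  locallySmall_of_faithful (AdditiveFunctor.forget _ _ ⋙
    (Functor.whiskeringLeft _ _ AddCommGrpCat.{u}).obj (equivSmallModel.{u} (FPMod R)).inverse)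

variable {R}

/-- The subgroup of `M ⊗[ℤ] L` generated by the elements `m r ⊗ l - m ⊗ r l`, for a right module `M`
(a module over `Rᵐᵒᵖ`) and a left module `L`. -/
def balanced (M : ModuleCat.{u} Rᵐᵒᵖ) (L : ModuleCat.{u} R) : AddSubgroup (M ⊗[ℤ] L) :=
  AddSubgroup.closure
    {z | ∃ (m : M) (r : R) (l : L), z = (MulOpposite.op r • m) ⊗ₜ[ℤ] l - m ⊗ₜ[ℤ] (r • l)}

/-- The tensor product `M ⊗_R L` of a right module and a left module over a (noncommutative) ring. -/
def tensorObj (M : ModuleCat.{u} Rᵐᵒᵖ) (L : ModuleCat.{u} R) : AddCommGrpCat.{u} :=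
  AddCommGrpCat.of ((M ⊗[ℤ] L) ⧸ balanced M L)

def tmul {M : ModuleCat.{u} Rᵐᵒᵖ} {L : ModuleCat.{u} R} (m : M) (l : L) : tensorObj M L :=
  QuotientAddGroup.mk' (balanced M L) (m ⊗ₜ[ℤ] l)

def tensorMap {M M' : ModuleCat.{u} Rᵐᵒᵖ} {L L' : ModuleCat.{u} R} (f : M ⟶ M') (g : L ⟶ L') :
    tensorObj M L ⟶ tensorObj M' L' :=
  AddCommGrpCat.ofHom <| QuotientAddGroup.map (balanced M L) (balanced M' L')
    (TensorProduct.map f.hom.toAddMonoidHom.toIntLinearMap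
      g.hom.toAddMonoidHom.toIntLinearMap).toAddMonoidHom (by
    rw [balanced, AddSubgroup.closure_le]
    rintro _ ⟨m, r, l, rfl⟩
    refine AddSubgroup.subset_closure ⟨f m, r, g l, ?_⟩
    simp)

lemma tensorMap_tmul {M M' : ModuleCat.{u} Rᵐᵒᵖ} {L L' : ModuleCat.{u} R} (f : M ⟶ M')
    (g : L ⟶ L') (m : M) (l : L) : tensorMap f g (tmul m l) = tmul (f m) (g l) := rfl

lemma tmul_smul {M : ModuleCat.{u} Rᵐᵒᵖ} {L : ModuleCat.{u} R} (m : M) (r : R) (l : L) :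
    tmul m (r • l) = tmul (MulOpposite.op r • m) l := by
  refine ((QuotientAddGroup.mk'_eq_mk' _).2 ⟨_, AddSubgroup.subset_closure ⟨m, r, l, rfl⟩, ?_⟩)
  abel

lemma tmul_add {M : ModuleCat.{u} Rᵐᵒᵖ} {L : ModuleCat.{u} R} (m : M) (l l' : L) :
    tmul m (l + l') = tmul m l + tmul m l' := by
  rw [tmul, TensorProduct.tmul_add, map_add]; rfl

lemma add_tmul {M : ModuleCat.{u} Rᵐᵒᵖ} {L : ModuleCat.{u} R} (m m' : M) (l : L) :
    tmul (m + m') l = tmul m l + tmul m' l := by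
  rw [tmul, TensorProduct.add_tmul, map_add]; rfl

lemma tensor_ind {M : ModuleCat.{u} Rᵐᵒᵖ} {L : ModuleCat.{u} R} {p : tensorObj M L → Prop}
    (h : ∀ m l, p (tmul m l)) (h0 : p 0) (hadd : ∀ x y, p x → p y → p (x + y)) (x) : p x := by
  obtain ⟨x, rfl⟩ := QuotientAddGroup.mk'_surjective (balanced M L) x
  induction x with
  | zero => rw [map_zero]; exact h0
  | tmul m l => exact h m l
  | add x y hx hy => rw [map_add]; exact hadd _ _ hx hy

lemma tensor_ext {M : ModuleCat.{u} Rᵐᵒᵖ} {L : ModuleCat.{u} R} {A : AddCommGrpCat.{u}}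
    {f g : tensorObj M L ⟶ A} (h : ∀ m l, f (tmul m l) = g (tmul m l)) : f = g := by
  ext x
  induction x using tensor_ind with
  | h m l => exact h m l
  | h0 => simp
  | hadd x y hx hy => simp [hx, hy]

variable (R) in
/-- The bifunctor `M ⊗_R L`. -/
def tensorFunctor : ModuleCat.{u} Rᵐᵒᵖ ⥤ ModuleCat.{u} R ⥤ AddCommGrpCat.{u} where
  obj M :=
    { obj L := tensorObj M L
      map g := tensorMap (𝟙 M) g
      map_id _ := tensor_ext fun _ _ => rfl
      map_comp _ _ := tensor_ext fun _ _ => rfl }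
  map f :=
    { app L := tensorMap f (𝟙 L)
      naturality _ _ _ := tensor_ext fun _ _ => rfl }
  map_id _ := by ext L : 2; exact tensor_ext fun _ _ => rfl
  map_comp _ _ := by ext L : 2; exact tensor_ext fun _ _ => rfl

instance (M : ModuleCat.{u} Rᵐᵒᵖ) : ((tensorFunctor R).obj M).Additive :=
  ⟨tensor_ext fun m l => by
    change tensorMap _ _ _ = tensorMap _ _ _ + tensorMap _ _ _
    simp only [tensorMap_tmul]
    exact tmul_add _ _ _⟩

instance (L : ModuleCat.{u} R) : ((tensorFunctor R).flip.obj L).Additive :=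
  ⟨tensor_ext fun m l => by
    change tensorMap _ _ _ = tensorMap _ _ _ + tensorMap _ _ _
    simp only [tensorMap_tmul]
    exact add_tmul _ _ _⟩

variable (R) in
/-- The tensor embedding `t : Mod(R) ⥤ (mod(Rᵒᵖ), Ab)`, `t(M) = M ⊗_R -`, on all right modules. -/
def tensorEmbedding : ModuleCat.{u} Rᵐᵒᵖ ⥤ FPModAb R where
  obj M := AdditiveFunctor.of ((isFPMod R).ι ⋙ (tensorFunctor R).obj M)
  map f := ObjectProperty.homMk (Functor.whiskerLeft _ ((tensorFunctor R).map f))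

instance : (tensorEmbedding R).Additive := ⟨by
  intro M N f g
  ext L : 3
  exact ((tensorFunctor R).flip.obj L.obj).map_add⟩

variable (R) in
/-- The Auslander-Gruson-Jensen functor `D_A = R₀(t ∘ w)`: the zeroth right derived functor of the
contravariant functor `t ∘ w : fp(Mod(R), Ab)ᵒᵖ ⥤ (mod(Rᵒᵖ), Ab)`, computed by injective resolutions
in `fp(Mod(R), Ab)ᵒᵖ`, i.e. projective resolutions in `fp(Mod(R), Ab)`. -/
noncomputable def DA : (IsFinPres (ModuleCat.{u} Rᵐᵒᵖ)).FullSubcategory ⥤ (FPModAb R)ᵒᵖ :=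
  (((wFunctor (ModuleCat.{u} Rᵐᵒᵖ)).leftOp ⋙ tensorEmbedding R).rightDerived 0).rightOp

/-- The functor `M ↦ Nat(G, M ⊗_R -)` on right modules. The groups `Nat(G, M ⊗_R -)` are essentially
small, and `Shrink` is the transport of such a group to the universe of the modules. -/
noncomputable def DRObj (G : FPModAb R) : ModuleCat.{u} Rᵐᵒᵖ ⥤ AddCommGrpCat.{u} where
  obj M := AddCommGrpCat.of (Shrink.{u} (G ⟶ (tensorEmbedding R).obj M))
  map f := AddCommGrpCat.ofHom
    { toFun x := equivShrink _ ((equivShrink _).symm x ≫ (tensorEmbedding R).map f)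
      map_zero' := (Equiv.symm_apply_eq _).1 (by simp)
      map_add' := by simp [← equivShrink_add] }
  map_id M := by ext; simp
  map_comp f g := by ext; simp

/-- The map `Rⁿ ⟶ A` of right modules which sends the standard basis to `a`. -/
def freeLift {n : ℕ} {A : ModuleCat.{u} Rᵐᵒᵖ} (a : Fin n → A) :
    ModuleCat.of Rᵐᵒᵖ (Fin n → R) ⟶ A :=
  ModuleCat.ofHom
    { toFun c := ∑ i, MulOpposite.op (c i) • a i
      map_add' c d := by simp [add_smul, Finset.sum_add_distrib]
      map_smul' s c := by
        simp only [RingHom.id_apply, Finset.smul_sum, smul_smul]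
        rfl }

lemma freeLift_apply {n : ℕ} {A : ModuleCat.{u} Rᵐᵒᵖ} (a : Fin n → A) (c : Fin n → R) :
    freeLift a c = ∑ i, MulOpposite.op (c i) • a i := rfl

lemma freeLift_single {n : ℕ} {A : ModuleCat.{u} Rᵐᵒᵖ} (a : Fin n → A) (i : Fin n) :
    freeLift a (Pi.single i (1 : R)) = a i := by
  rw [freeLift_apply, Finset.sum_eq_single i]
  · simp
  · intro j _ h; simp [h]
  · simp

lemma free_ext {n : ℕ} {A : ModuleCat.{u} Rᵐᵒᵖ} (g h : ModuleCat.of Rᵐᵒᵖ (Fin n → R) ⟶ A)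
    (e : ∀ i, g (Pi.single i (1 : R)) = h (Pi.single i (1 : R))) : g = h := by
  refine ConcreteCategory.hom_ext _ _ fun (c : Fin n → R) => ?_
  have : c = ∑ i, MulOpposite.op (c i) • (Pi.single i (1 : R) : Fin n → R) := by
    ext j; simp [Finset.sum_apply, Pi.single_apply]
  rw [this, map_sum, map_sum]
  refine Finset.sum_congr rfl fun i _ => ?_
  exact (map_smul g.hom _ _).trans ((congrArg _ (e i)).trans (map_smul h.hom _ _).symm)

lemma tmul_zero {M : ModuleCat.{u} Rᵐᵒᵖ} {L : ModuleCat.{u} R} (m : M) :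
    tmul m (0 : L) = 0 := by
  rw [tmul, TensorProduct.tmul_zero, map_zero]; rfl

lemma tmul_sum {M : ModuleCat.{u} Rᵐᵒᵖ} {L : ModuleCat.{u} R} {ι : Type*} (s : Finset ι) (m : M)
    (l : ι → L) : tmul m (∑ i ∈ s, l i) = ∑ i ∈ s, tmul m (l i) := by
  simp only [tmul, TensorProduct.tmul_sum, map_sum]; rfl

lemma sum_tmul {M : ModuleCat.{u} Rᵐᵒᵖ} {L : ModuleCat.{u} R} {ι : Type*} (s : Finset ι) (m : ι → M)
    (l : L) : tmul (∑ i ∈ s, m i) l = ∑ i ∈ s, tmul (m i) l := by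
  simp only [tmul, TensorProduct.sum_tmul, map_sum]; rfl

/-- Right exactness of the tensor product, in the form of an equational criterion. -/
lemma vanish {n m : ℕ} {A : ModuleCat.{u} Rᵐᵒᵖ} {L : ModuleCat.{u} R} (π : (Fin n → R) →ₗ[R] L)
    (hπ : Function.Surjective π) (r : Fin m → Fin n → R)
    (hr : Submodule.span R (Set.range r) = LinearMap.ker π) (a : Fin n → A)
    (ha : ∑ i, tmul (a i) (π (Pi.single i 1)) = 0) :
    ∃ b : Fin m → A, ∀ i, a i = ∑ j, MulOpposite.op (r j i) • b j := by
  let B : AddSubgroup (Fin n → A) := AddMonoidHom.range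
    (AddMonoidHom.mk' (fun b : Fin m → A => fun i => ∑ j, MulOpposite.op (r j i) • b j)
      (fun b c => by ext i; simp [smul_add, Finset.sum_add_distrib]))
  let q : (Fin n → A) →+ (Fin n → A) ⧸ B := QuotientAddGroup.mk' B
  have wd (x : A) (c d : Fin n → R) (h : π c = π d) :
      q (fun i => MulOpposite.op (c i) • x) = q (fun i => MulOpposite.op (d i) • x) := by
    rw [← sub_eq_zero, ← map_sub, QuotientAddGroup.mk'_apply, QuotientAddGroup.eq_zero_iff]
    have hk : c - d ∈ LinearMap.ker π := by simp [h]
    rw [← hr, Submodule.mem_span_range_iff_exists_fun] at hk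
    obtain ⟨e, he⟩ := hk
    refine ⟨fun j => MulOpposite.op (e j) • x, ?_⟩
    ext i
    have := congrFun he i
    simp only [AddMonoidHom.mk'_apply, Pi.sub_apply, ← sub_smul, ← MulOpposite.op_sub] at this ⊢
    rw [← this]
    simp [smul_smul, Finset.sum_smul, Finset.sum_apply]
  choose σ hσ using hπ
  let Φ₀ : A →+ L →+ (Fin n → A) ⧸ B := AddMonoidHom.mk' (fun x =>
      AddMonoidHom.mk' (fun l => q (fun i => MulOpposite.op (σ l i) • x)) (fun l l' => by
        rw [wd x (σ (l + l')) (σ l + σ l') (by simp [hσ]), ← map_add]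
        congr 1; ext i; simp [add_smul]))
      (fun x y => by
        ext l
        change q _ = q _ + q _
        rw [← map_add]
        congr 1; ext i; simp [smul_add])
  have hΦ₀ (x : A) (c : Fin n → R) : Φ₀ x (π c) = q (fun i => MulOpposite.op (c i) • x) :=
    wd x _ _ (hσ _)
  let Φ₁ : A ⊗[ℤ] L →+ (Fin n → A) ⧸ B := TensorProduct.liftAddHom Φ₀ (fun z x l => by simp)
  let Φ : tensorObj A L →+ (Fin n → A) ⧸ B := QuotientAddGroup.lift (balanced A L) Φ₁ (by
    rw [balanced, AddSubgroup.closure_le]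
    rintro _ ⟨x, s, l, rfl⟩
    change Φ₁ _ = 0
    rw [map_sub, sub_eq_zero]
    change Φ₀ (MulOpposite.op s • x) l = Φ₀ x (s • l)
    rw [← hσ l, ← map_smul, hΦ₀, hΦ₀]
    congr 1; ext i; simp [smul_smul])
  have hΦ (x : A) (c : Fin n → R) : Φ (tmul x (π c)) = q (fun i => MulOpposite.op (c i) • x) :=
    hΦ₀ x c
  have h0 := congrArg Φ ha
  rw [map_sum, map_zero] at h0
  simp only [hΦ] at h0
  rw [← map_sum] at h0
  have : (∑ i, fun k => MulOpposite.op ((Pi.single i (1 : R) : Fin n → R) k) • a i) = a := by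
    ext k
    rw [Finset.sum_apply, Finset.sum_eq_single k]
    · simp
    · intro j _ h; simp [h.symm]
    · simp
  rw [this, QuotientAddGroup.mk'_apply, QuotientAddGroup.eq_zero_iff] at h0
  obtain ⟨b, hb⟩ := h0
  exact ⟨b, fun i => (congrFun hb i).symm⟩

lemma isFinPres_tensor (L : FPMod R) :
    IsFinPres (ModuleCat.{u} Rᵐᵒᵖ) ((tensorFunctor R).flip.obj L.obj) := by
  have : Module.FinitePresentation R L.obj := L.property
  obtain ⟨n, K, e, hK⟩ := Module.FinitePresentation.exists_fin R L.obj
  obtain ⟨m, r, hr⟩ := Submodule.fg_iff_exists_fin_generating_family.1 hK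
  let π : (Fin n → R) →ₗ[R] L.obj := e.symm.toLinearMap ∘ₗ K.mkQ
  have hπ : Function.Surjective π := e.symm.surjective.comp K.mkQ_surjective
  have hker : LinearMap.ker π = K := by simp [π, LinearMap.ker_comp]
  rw [← hker] at hr
  let X := ModuleCat.of Rᵐᵒᵖ (Fin n → R)
  let Y := ModuleCat.of Rᵐᵒᵖ (Fin m → R)
  let E (k : ℕ) (i : Fin k) : ModuleCat.of Rᵐᵒᵖ (Fin k → R) := (Pi.single i (1 : R) : Fin k → R)
  let f : X ⟶ Y := freeLift fun i => (fun j => r j i : Fin m → R)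
  let x : tensorObj X L.obj := ∑ i, tmul (E n i) (π (Pi.single i 1))
  have hx {A : ModuleCat.{u} Rᵐᵒᵖ} (g : X ⟶ A) :
      ((tensorFunctor R).flip.obj L.obj).map g x = ∑ i, tmul (g (E n i)) (π (Pi.single i 1)) := by
    change (tensorMap g (𝟙 L.obj)) (∑ i, tmul (E n i) (π (Pi.single i 1))) = _
    rw [map_sum]; rfl
  have hs (c : Fin n → R) : ∑ i, c i • π (Pi.single i 1) = π c := by
    simp only [← map_smul, ← map_sum]
    congr 1
    ext j; simp [Finset.sum_apply, Pi.single_apply]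
  have hf {A : ModuleCat.{u} Rᵐᵒᵖ} (b : Fin m → A) (i : Fin n) :
      (f ≫ freeLift b) (E n i) = ∑ j, MulOpposite.op (r j i) • b j := by
    change freeLift b (f (E n i)) = _
    rw [freeLift_single]; rfl
  refine (isFinPres_iff _).2 ⟨X, Y, f, x, fun A s => ?_, fun A g => ?_⟩
  · change tensorObj A L.obj at s
    induction s using tensor_ind with
    | h a l =>
      obtain ⟨c, rfl⟩ := hπ l
      refine ⟨freeLift fun i => MulOpposite.op (c i) • a, ?_⟩
      rw [hx]
      have (i : Fin n) : tmul (freeLift (fun i => MulOpposite.op (c i) • a) (E n i))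
          (π (Pi.single i 1)) = tmul a (c i • π (Pi.single i 1)) := by
        rw [freeLift_single, tmul_smul]
      refine (Finset.sum_congr rfl fun i _ => this i).trans ?_
      rw [← tmul_sum, hs]
    | h0 => exact ⟨0, by rw [Functor.map_zero]; rfl⟩
    | hadd s s' h h' =>
      obtain ⟨g, rfl⟩ := h
      obtain ⟨g', rfl⟩ := h'
      exact ⟨g + g', by rw [Functor.map_add]; rfl⟩
  · rw [hx]
    constructor
    · intro h
      obtain ⟨b, hb⟩ := vanish π hπ r hr _ h
      exact ⟨freeLift b, free_ext _ _ fun i => (hf b i).trans (hb i).symm⟩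
    · rintro ⟨h, rfl⟩
      obtain ⟨b, rfl⟩ : ∃ b, h = freeLift b := ⟨fun j => h (E m j),
        free_ext _ _ fun j => (freeLift_single (fun j => h (E m j)) j).symm⟩
      have : ∀ j, ∑ i, r j i • π (Pi.single i 1) = 0 := fun j => by
        have : r j ∈ LinearMap.ker π := hr ▸ Submodule.subset_span ⟨j, rfl⟩
        rw [hs]; exact this
      simp only [hf, sum_tmul, ← tmul_smul]
      rw [Finset.sum_comm]
      simp only [← tmul_sum, this, tmul_zero, Finset.sum_const_zero]
      rfl

/-- The objectwise product of functors to abelian groups. -/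
def piFunctor {C : Type v} [Category.{u} C] {J : Type u} (F : J → C ⥤ AddCommGrpCat.{u}) :
    C ⥤ AddCommGrpCat.{u} where
  obj A := AddCommGrpCat.of (∀ j, (F j).obj A)
  map f := AddCommGrpCat.ofHom (AddMonoidHom.mk' (fun s j => (F j).map f (s j))
    (fun s t => by ext j; exact map_add _ _ _))
  map_id A := by ext s j; exact ConcreteCategory.congr_hom ((F j).map_id A) (s j)
  map_comp f g := by ext s j; exact map_comp_app (F j) f g (s j)

def piProj {C : Type v} [Category.{u} C] {J : Type u} (F : J → C ⥤ AddCommGrpCat.{u}) (j : J) :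
    piFunctor F ⟶ F j where
  app A := AddCommGrpCat.ofHom (Pi.evalAddMonoidHom (fun j => (F j).obj A) j)
  naturality _ _ _ := rfl

def piLift {C : Type v} [Category.{u} C] {J : Type u} {F : J → C ⥤ AddCommGrpCat.{u}}
    {P : C ⥤ AddCommGrpCat.{u}} (b : ∀ j, P ⟶ F j) : P ⟶ piFunctor F where
  app A := AddCommGrpCat.ofHom (AddMonoidHom.mk' (fun s j => (b j).app A s)
    (fun s t => by ext j; exact map_add _ _ _))
  naturality A B f := by ext s; exact funext fun j => nat_app (b j) f s

lemma isFinPres_piFunctor {C : Type v} [Category.{u} C] [Abelian C] [HasCoproducts.{u} C] {J : Type u}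
    {F : J → C ⥤ AddCommGrpCat.{u}} (hF : ∀ j, IsFinPres C (F j)) : IsFinPres C (piFunctor F) :=
  IsFinPres.of_product hF
    (piProj F)
    (fun _ _ _ h => funext h) (fun _ s => ⟨s, fun _ => rfl⟩)

lemma isFinPres_DRObj (G : FPModAb R) : IsFinPres (ModuleCat.{u} Rᵐᵒᵖ) (DRObj G) := by
  let S := SmallModel.{u} (FPMod R)
  let V : S ⥤ FPMod R := (equivSmallModel.{u} (FPMod R)).inverse
  let J₁ : Type u := Σ s : S, G.obj.obj (V.obj s)
  let J₂ : Type u := Σ s : S, G.obj.obj (V.obj s) × G.obj.obj (V.obj s)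
  let J₃ : Type u := Σ (s s' : S), (s ⟶ s') × G.obj.obj (V.obj s)
  let T (L : FPMod R) := (tensorFunctor R).flip.obj L.obj
  let F₁ (j : J₁) := T (V.obj j.1)
  let P₁ := piFunctor F₁
  let F₂ (j : J₂ ⊕ J₃) := T (V.obj (j.elim (fun j => j.1) (fun j => j.2.1)))
  let act {s s' : S} (f : s ⟶ s') : T (V.obj s) ⟶ T (V.obj s') :=
    (tensorFunctor R).flip.map (V.map f).hom
  let e (s : S) (g : G.obj.obj (V.obj s)) : P₁ ⟶ T (V.obj s) := piProj F₁ ⟨s, g⟩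
  let b : ∀ j, P₁ ⟶ F₂ j
    | .inl ⟨s, g, g'⟩ => (e s (g + g') - (e s g + e s g') : P₁ ⟶ T (V.obj s))
    | .inr ⟨s, s', f, g⟩ => (e s' (G.obj.map (V.map f) g) - e s g ≫ act f : P₁ ⟶ T (V.obj s'))
  let a : P₁ ⟶ piFunctor F₂ := piLift b
  let i : DRObj G ⟶ P₁ :=
    { app A := AddCommGrpCat.ofHom (AddMonoidHom.mk'
        (fun x j => ((equivShrink _).symm x).hom.app (V.obj j.1) j.2)
        (fun x y => by
          ext j
          rw [equivShrink_symm_add]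
          rfl))
      naturality A B h := by
        ext x
        funext j
        change ((equivShrink _).symm (equivShrink _ ((equivShrink _).symm x ≫ (tensorEmbedding R).map h))).hom.app
          (V.obj j.1) j.2 = _
        rw [Equiv.symm_apply_apply]
        rfl }
  have inj (A) : Function.Injective (i.app A) := by
    intro x y h
    refine (equivShrink _).symm.injective ?_
    have h' (s : S) (g : G.obj.obj (V.obj s)) : ((equivShrink _).symm x).hom.app (V.obj s) g =
      ((equivShrink _).symm y).hom.app (V.obj s) g := congrFun h ⟨s, g⟩
    have : Functor.Faithful ((Functor.whiskeringLeft _ _ AddCommGrpCat.{u}).obj V) := inferInstance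
    refine ObjectProperty.hom_ext _ (((Functor.whiskeringLeft _ _ AddCommGrpCat.{u}).obj V).map_injective ?_)
    ext s g
    exact h' s g
  have ex (A) : Function.Exact (i.app A) (a.app A) := by
    intro y
    constructor
    · intro h
      have h2 (s : S) (g g' : G.obj.obj (V.obj s)) : y ⟨s, g + g'⟩ = y ⟨s, g⟩ + y ⟨s, g'⟩ :=
        sub_eq_zero.1 (congrFun h (.inl ⟨s, g, g'⟩))
      have h3 (s s' : S) (f : s ⟶ s') (g : G.obj.obj (V.obj s)) :
          y ⟨s', G.obj.map (V.map f) g⟩ = (act f).app A (y ⟨s, g⟩) :=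
        sub_eq_zero.1 (congrFun h (.inr ⟨s, s', f, g⟩))
      let η : V ⋙ G.obj ⟶ V ⋙ ((tensorEmbedding R).obj A).obj :=
        { app s := AddCommGrpCat.ofHom (AddMonoidHom.mk' (fun g => y ⟨s, g⟩) (h2 s))
          naturality s s' f := by ext g; exact h3 s s' f g }
      have : Functor.Full ((Functor.whiskeringLeft _ _ AddCommGrpCat.{u}).obj V) := inferInstance
      obtain ⟨θ, hθ⟩ := ((Functor.whiskeringLeft _ _ AddCommGrpCat.{u}).obj V).map_surjective η
      refine ⟨equivShrink _ (ObjectProperty.homMk θ), ?_⟩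
      funext j
      change ((equivShrink _).symm (equivShrink _ (ObjectProperty.homMk θ))).hom.app
          (V.obj j.1) j.2 = _
      rw [Equiv.symm_apply_apply]
      exact ConcreteCategory.congr_hom (NatTrans.congr_app hθ j.1) j.2
    · rintro ⟨x, rfl⟩
      refine funext fun j => ?_
      obtain (⟨s, g, g'⟩ | ⟨s, s', f, g⟩) := j
      · refine sub_eq_zero.2 ?_
        exact map_add (((equivShrink _).symm x).hom.app (V.obj s)).hom g g'
      · refine sub_eq_zero.2 ?_
        exact nat_app ((equivShrink _).symm x).hom (V.map f) g
  have : (DRObj G).Additive := ⟨by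
    intro A B f g
    ext x
    change equivShrink _ ((equivShrink _).symm x ≫ (tensorEmbedding R).map (f + g)) =
      equivShrink _ ((equivShrink _).symm x ≫ (tensorEmbedding R).map f) +
        equivShrink _ ((equivShrink _).symm x ≫ (tensorEmbedding R).map g)
    rw [Functor.map_add, Preadditive.comp_add, equivShrink_add]⟩
  exact IsFinPres.of_ker (isFinPres_piFunctor fun j => isFinPres_tensor _) (isFinPres_piFunctor fun j => isFinPres_tensor _)
    i a ex inj

variable (R) in
/-- The contravariant functor `D_R`, `(D_R G)(M) = Nat(G, M ⊗_R -)`, with values in `fp(Mod(R), Ab)`;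
it acts on morphisms by precomposition. -/
noncomputable def DR : (FPModAb R)ᵒᵖ ⥤ (IsFinPres (ModuleCat.{u} Rᵐᵒᵖ)).FullSubcategory where
  obj G := ⟨DRObj G.unop, isFinPres_DRObj G.unop⟩
  map {G H} α := ObjectProperty.homMk
    { app M := AddCommGrpCat.ofHom
        { toFun x := equivShrink _ (α.unop ≫ (equivShrink (G.unop ⟶ (tensorEmbedding R).obj M)).symm x)
          map_zero' := (Equiv.symm_apply_eq _).1 (by simp)
          map_add' := by simp [← equivShrink_add] }
      naturality M N f := by
        ext x
        change equivShrink _ (α.unop ≫ (equivShrink _).symm (equivShrink _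
            ((equivShrink (G.unop ⟶ (tensorEmbedding R).obj M)).symm x ≫ (tensorEmbedding R).map f))) =
          equivShrink _ ((equivShrink _).symm (equivShrink _
            (α.unop ≫ (equivShrink (G.unop ⟶ (tensorEmbedding R).obj M)).symm x)) ≫ (tensorEmbedding R).map f)
        simp }
  map_id G := by
    ext M x
    change equivShrink _ (𝟙 G.unop ≫ (equivShrink (G.unop ⟶ (tensorEmbedding R).obj M)).symm x) = x
    rw [Category.id_comp]
    exact Equiv.apply_symm_apply _ _
  map_comp {G H K} α β := by
    ext M x
    change equivShrink _ ((β.unop ≫ α.unop) ≫ (equivShrink (G.unop ⟶ (tensorEmbedding R).obj M)).symm x) =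
      equivShrink _ (β.unop ≫ (equivShrink _).symm (equivShrink _
        (α.unop ≫ (equivShrink (G.unop ⟶ (tensorEmbedding R).obj M)).symm x)))
    simp

end

section
variable {C D : Type*} [Category C] [Category D] [HasZeroMorphisms D] [HasKernels D]

/-- The functor `X ↦ ker(α_X)`. -/
noncomputable def kernelFunctor {F G : C ⥤ D} (α : F ⟶ G) : C ⥤ D where
  obj X := kernel (α.app X)
  map f := kernel.map _ _ (F.map f) (G.map f) (α.naturality f).symm

/-- The kernel of a functor: the objects `X` with `H X ≅ 0`. -/
def kernelProp {D E : Type*} [Category D] [Category E] (H : D ⥤ E) : ObjectProperty D :=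
  fun X => IsZero (H.obj X)
end

end AGJ

/-! The adjunction. By Yoneda, `Nat((X,-), D_R G) ≅ (D_R G)(X) = Nat(G, X ⊗ -)`, so the value of a
left adjoint of `D_R` at `(X,-)` exists and is `X ⊗ -` (`corepresentableByTensor`). Every finitely
presented functor is a cokernel of a map between representables, so a left adjoint `E` exists
everywhere (`leftAdjointObjIsDefined_of_yonedaFP`). The Yoneda adjunction yields a comparison `E ⟶ w
⋙ t.op`; it is invertible on representables, hence on their retracts, the projectives. Seen
contravariantly, `E` is left exact, being a left adjoint, and a left exact functor is its own zeroth
right derived functor. Therefore `D_A = R₀(t ∘ w) ≅ R₀(E) ≅ E` (`DAIso`).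

The coreflection. The functor `D_R (L,-)` is `- ⊗ L`, which is right exact, and right exact functors
are injective in `fp` (`injective_of_rightExact`). Since elements of `(E F)(L)` correspond to maps
`F ⟶ D_R (L,-)`, which extend along monomorphisms, every left adjoint of `D_R` preserves
monomorphisms (`preservesMonomorphisms_of_adj`). A formal argument then finishes: `E` kills the
kernel of the unit because `E δ` is a split monomorphism, and every map into `F` from an object
killed by `E` factors uniquely through `ker δ_F`. -/

namespace AGJ

/-! ### The kernel of the unit of an adjunction. -/

section
variable {C D : Type*} [Category C] [Category D] [Abelian C] [Abelian D]

/-- The kernel of the unit of an adjunction whose left adjoint preserves monomorphisms is killed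
by the left adjoint. -/
lemma kernelProp_kernelFunctor_unit {L : C ⥤ D} {G : D ⥤ C} (adj : L ⊣ G)
    [L.PreservesMonomorphisms] (X : C) : kernelProp L ((kernelFunctor adj.unit).obj X) := by
  have : L.IsLeftAdjoint := adj.isLeftAdjoint
  change IsZero (L.obj (kernel (adj.unit.app X)))
  -- The triangle identity splits `L δ`, so `L` applied to the kernel inclusion is zero; it is also
  -- a monomorphism, hence its source is zero.
  have hs : L.map (adj.unit.app X) ≫ adj.counit.app (L.obj X) = 𝟙 _ := adj.left_triangle_components X
  have : Mono (L.map (adj.unit.app X)) := mono_of_mono_fac hs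
  have h0 : L.map (kernel.ι (adj.unit.app X)) ≫ L.map (adj.unit.app X) = 0 := by
    rw [← L.map_comp, kernel.condition, L.map_zero]
  have : Mono (kernel.ι (adj.unit.app X)) := inferInstance
  have : Mono (L.map (kernel.ι (adj.unit.app X))) := L.map_mono _
  exact IsZero.of_mono_eq_zero (L.map (kernel.ι (adj.unit.app X))) (zero_of_comp_mono _ h0)

/-- Maps `X ⟶ G (L Y)` correspond to maps `L X ⟶ L Y`, and `L X` is zero. -/
lemma comp_unit_eq_zero {L : C ⥤ D} {G : D ⥤ C} (adj : L ⊣ G) {X Y : C} (hX : kernelProp L X)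
    (f : X ⟶ Y) : f ≫ adj.unit.app Y = 0 :=
  (adj.homEquiv X (L.obj Y)).symm.injective (IsZero.eq_of_src hX _ _)

/-- The coreflection onto the kernel of a left adjoint, given by the kernel of the unit. -/
noncomputable def kernelCoreflection {L : C ⥤ D} {G : D ⥤ C} (adj : L ⊣ G)
    (h : ∀ X, kernelProp L ((kernelFunctor adj.unit).obj X)) :
    (kernelProp L).ι ⊣ (kernelProp L).lift (kernelFunctor adj.unit) h :=
  Adjunction.mkOfHomEquiv
    { homEquiv X Y :=
        { toFun f := ObjectProperty.homMk
            (kernel.lift (adj.unit.app Y) f (comp_unit_eq_zero adj X.property f))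
          invFun g := g.hom ≫ kernel.ι (adj.unit.app Y)
          left_inv f := kernel.lift_ι _ _ _
          right_inv g := by
            ext
            exact (cancel_mono (kernel.ι (adj.unit.app Y))).1 (kernel.lift_ι _ _ _) }
      homEquiv_naturality_left_symm f g := Category.assoc _ _ _
      homEquiv_naturality_right {X Y Y'} f g := by
        ext
        refine (cancel_mono (kernel.ι (adj.unit.app Y'))).1 ?_
        refine (kernel.lift_ι _ _ _).trans ?_
        change _ = (kernel.lift (adj.unit.app Y) f _ ≫ kernel.lift _ (kernel.ι _ ≫ g) _) ≫ _
        rw [Category.assoc, kernel.lift_ι, kernel.lift_ι_assoc] }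

/-! ### Derived functors and invertibility on injectives. -/

/-- A natural transformation which is invertible on injective objects induces isomorphisms between
right derived functors. -/
lemma isIso_rightDerived [HasInjectiveResolutions C] {F G : C ⥤ D} [F.Additive] [G.Additive]
    (α : F ⟶ G) (hα : ∀ (X : C) [Injective X], IsIso (α.app X)) (n : ℕ) :
    IsIso (NatTrans.rightDerived α n) := by
  refine (NatTrans.isIso_iff_isIso_app _).2 fun X => ?_
  have (i : ℕ) : IsIso (((NatTrans.mapHomologicalComplex α (ComplexShape.up ℕ)).app
      (injectiveResolution X).cocomplex).f i) := hα ((injectiveResolution X).cocomplex.X i)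
  have : IsIso ((NatTrans.mapHomologicalComplex α (ComplexShape.up ℕ)).app
      (injectiveResolution X).cocomplex) := HomologicalComplex.Hom.isIso_of_components _
  rw [InjectiveResolution.rightDerived_app_eq α (injectiveResolution X) n]
  infer_instance

/-- The zeroth right derived functor of `F` is `G` if `G` is left exact and agrees with `F` on
injective objects. -/
noncomputable def rightDerivedZeroIso [HasInjectiveResolutions C] {F G : C ⥤ D} [F.Additive]
    [G.Additive] [PreservesFiniteLimits G] (α : F ⟶ G)
    (hα : ∀ (X : C) [Injective X], IsIso (α.app X)) : F.rightDerived 0 ≅ G :=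
  have := isIso_rightDerived α hα 0
  asIso (NatTrans.rightDerived α 0) ≪≫ G.rightDerivedZeroIsoSelf

/-- Used to pass from representables to arbitrary projectives. -/
lemma isIso_app_of_retract {C D : Type*} [Category C] [Category D] {F G : C ⥤ D} (α : F ⟶ G)
    {X Y : C} (r : Retract X Y)
    [IsIso (α.app Y)] : IsIso (α.app X) := by
  refine ⟨G.map r.i ≫ inv (α.app Y) ≫ F.map r.r, ?_, ?_⟩
  · rw [← α.naturality_assoc, IsIso.hom_inv_id_assoc, ← F.map_comp, r.retract, F.map_id]
  · simp only [Category.assoc, α.naturality, IsIso.inv_hom_id_assoc]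
    rw [← G.map_comp, r.retract, G.map_id]

end
-- Comparing a left adjoint with `w ⋙ t`.
section
variable {A C D : Type*} [Category A] [Category C] [Category D] {Y : C ⥤ A} {w : A ⥤ C} {G : D ⥤ A}
  {L : A ⥤ D} {t : C ⥤ D}

/-- The transformation `L ⟶ w ⋙ t` of left adjoints induced by a transformation `Y ⟶ t ⋙ G`,
where `w ⊣ Y` and `L ⊣ G`. -/
def leftAdjointComparison (adj : w ⊣ Y) (adj' : L ⊣ G) (β : Y ⟶ t ⋙ G) : L ⟶ w ⋙ t where
  app F := (adj'.homEquiv _ _).symm (adj.unit.app F ≫ β.app (w.obj F))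
  naturality F F' f := by
    have h2 := β.naturality (w.map f)
    rw [← adj'.homEquiv_naturality_left_symm, ← adj'.homEquiv_naturality_right_symm,
      ← adj.unit_naturality_assoc, Category.assoc]
    exact congrArg (fun a => (adj'.homEquiv _ _).symm (adj.unit.app F ≫ a)) h2

/-- The hypothesis `hX` says that `β.app X` exhibits `t X` as the value of the left adjoint at `Y
X`. As `Y` is fully faithful, `w (Y X) ≅ X`, so the comparison at `Y X` is this identification. -/
lemma isIso_leftAdjointComparison_app (adj : w ⊣ Y) (adj' : L ⊣ G) (β : Y ⟶ t ⋙ G) [Y.Full]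
    [Y.Faithful] (X : C)
    (hX : ∀ Z, Function.Bijective fun g : t.obj X ⟶ Z => β.app X ≫ G.map g) :
    IsIso ((leftAdjointComparison adj adj' β).app (Y.obj X)) := by
  refine isIso_of_coyoneda_map_bijective _ fun Z => ?_
  let e : t.obj (w.obj (Y.obj X)) ≅ t.obj X := t.mapIso (asIso (adj.counit.app X))
  -- Precomposition with the comparison is a composite of three bijections: transport along `e`, the
  -- universal property `hX`, and transposition under `adj'`.
  have hb := (adj'.homEquiv _ Z).symm.bijective.comp ((hX Z).comp (e.homFromEquiv (Z := Z)).bijective)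
  refine (congrArg Function.Bijective (funext fun g => ?_)).mpr hb
  refine (adj'.homEquiv_naturality_right_symm _ _).symm.trans ?_
  refine congrArg (adj'.homEquiv _ Z).symm ?_
  have h1 : adj.unit.app (Y.obj X) = Y.map (inv (adj.counit.app X)) := by
    rw [Functor.map_inv]
    exact IsIso.eq_inv_of_inv_hom_id (adj.right_triangle_components X)
  have h2 : Y.map (inv (adj.counit.app X)) ≫ β.app (w.obj (Y.obj X)) =
      β.app X ≫ G.map (t.map (inv (adj.counit.app X))) := β.naturality (inv (adj.counit.app X))
  rw [h1, h2]
  simp [e]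

end

/-! ### Presentations by representables, and injectives in `fp(C, Ab)`. -/

section
variable {C : Type v} [Category.{u} C] [Abelian C]

lemma exists_epi_yonedaFP (F : (IsFinPres C).FullSubcategory) :
    ∃ (X : C) (p : (yonedaFP C).obj (op X) ⟶ F), Epi p := by
  have := F.property.additive
  obtain ⟨X, Z, f, x, h1, h2⟩ := (isFinPres_iff F.obj).1 F.property
  have : Epi (ofElt F.obj x) := by
    have : ∀ A, Epi ((ofElt F.obj x).app A) := fun A =>
      (AddCommGrpCat.epi_iff_surjective _).2 (h1 A)
    exact NatTrans.epi_of_epi_app _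
  exact ⟨X, ObjectProperty.homMk (ofElt F.obj x), Functor.epi_of_epi_map (IsFinPres C).ι this⟩

/-- The objects at which a left adjoint is defined are closed under those colimits that `D` has, and
each `F` is a cokernel of a map of representables. -/
lemma leftAdjointObjIsDefined_of_yonedaFP {D : Type*} [Category D] [HasCoequalizers D]
    {G : D ⥤ (IsFinPres C).FullSubcategory}
    (h : ∀ X, G.leftAdjointObjIsDefined ((yonedaFP C).obj X)) (F) : G.leftAdjointObjIsDefined F := by
  obtain ⟨X, p, hp⟩ := exists_epi_yonedaFP F
  obtain ⟨Y, q, hq⟩ := exists_epi_yonedaFP (kernel p)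
  have w : (q ≫ kernel.ι p) ≫ p = 0 := by rw [Category.assoc, kernel.condition, comp_zero]
  let hc : IsColimit (CokernelCofork.ofπ p w) :=
    isCokernelEpiComp (Abelian.epiIsCokernelOfKernel _ (kernelIsKernel p)) q rfl
  refine Functor.leftAdjointObjIsDefined_of_isColimit hc ?_
  rintro (_ | _)
  · exact h _
  · exact h _

/-- Natural transformations out of a finitely presented functor with prescribed value at the
generating element. -/
lemma exists_hom_of_elt {F T : C ⥤ AddCommGrpCat.{u}} [F.Additive] [T.Additive] {X Y : C}
    {f : X ⟶ Y} {x : F.obj X} (h1 : ∀ A (s : F.obj A), ∃ g : X ⟶ A, F.map g x = s)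
    (h2 : ∀ A (g : X ⟶ A), F.map g x = 0 → ∃ h : Y ⟶ A, f ≫ h = g)
    (t : T.obj X) (ht : T.map f t = 0) : ∃ φ : F ⟶ T, φ.app X x = t := by
  -- The transformation has to send `F.map g x` to `T.map g t`; this is independent of `g` because
  -- the relations on `x` all factor through `f`, which kills `t`.
  have wd (A : C) (g g' : X ⟶ A) (h : F.map g x = F.map g' x) : T.map g t = T.map g' t := by
    obtain ⟨k, hk⟩ := h2 A (g - g') (by rw [F.map_sub]; exact sub_eq_zero.2 h)
    have : T.map (g - g') t = 0 := by rw [← hk, map_comp_app, ht, map_zero]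
    rw [T.map_sub] at this
    exact sub_eq_zero.1 this
  choose c hc using h1
  refine ⟨{ app A := AddCommGrpCat.ofHom (AddMonoidHom.mk' (fun s => T.map (c A s) t) fun s s' => ?_)
            naturality A B k := ?_ }, ?_⟩
  · refine (wd A _ (c A s + c A s') ?_).trans ?_
    · rw [hc, F.map_add]; exact (congrArg₂ _ (hc _ _) (hc _ _)).symm
    · rw [T.map_add]; rfl
  · ext s
    refine (wd B _ (c A s ≫ k) ?_).trans (map_comp_app _ _ _ _)
    rw [hc, map_comp_app, hc]; rfl
  · refine (wd X _ (𝟙 X) (by rw [hc, F.map_id]; rfl)).trans ?_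
    rw [T.map_id]; rfl

/-- A finitely presented functor which is right exact is injective in `fp(C, Ab)`. -/
lemma injective_of_rightExact (T : (IsFinPres C).FullSubcategory)
    (hT : ∀ {X Y : C} (j : X ⟶ Y) (y : T.obj.obj Y), T.obj.map (cokernel.π j) y = 0 →
      ∃ x, T.obj.map j x = y) : Injective T := ⟨by
  intro F G φ i hi
  have : Mono i.hom := inferInstanceAs (Mono ((IsFinPres C).ι.map i))
  have := F.property.additive
  have := G.property.additive
  have := T.property.additive
  obtain ⟨X, Y, f, x, h1, h2⟩ := (isFinPres_iff F.obj).1 F.property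
  obtain ⟨X', Y', f', x', h1', h2'⟩ := (isFinPres_iff G.obj).1 G.property
  obtain ⟨c, hc⟩ := h1' X (i.hom.app X x)
  -- An extension of `φ` along `i` amounts to some `t` in `T X'` with `T c t = φ x` and `T f' t =
  -- 0`, that is, a preimage under `T j` of the image of `φ x` in `T (X ⊞ Y')`. The cokernel of `j`
  -- is the pushout of `c` and `f'`.
  let j : X' ⟶ X ⊞ Y' := biprod.lift c (-f')
  have hj : c ≫ biprod.inl ≫ cokernel.π j = f' ≫ biprod.inr ≫ cokernel.π j := by
    have := cokernel.condition j
    simp only [j, biprod.lift_eq, Preadditive.add_comp, Category.assoc, Preadditive.neg_comp] at this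
    exact add_neg_eq_zero.1 this
  -- The only use of `i` being a monomorphism: in `G` this element vanishes, since there `c` may be
  -- replaced by `f'`. Hence `X ⟶ coker j` factors through `f`, and `T f` kills `φ x`.
  have hx : F.obj.map (biprod.inl ≫ cokernel.π j) x = 0 := by
    refine inj_app i.hom _ ?_
    rw [map_zero, nat_app, ← hc, ← map_comp_app]
    exact (h2' _ _).2 ⟨biprod.inr ≫ cokernel.π j, hj.symm⟩
  obtain ⟨h, hh⟩ := (h2 _ _).1 hx
  have hτ : T.obj.map f (φ.hom.app X x) = 0 := by
    rw [← nat_app, (h2 Y f).2 ⟨𝟙 Y, Category.comp_id f⟩, map_zero]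
  obtain ⟨t, ht⟩ := hT j (T.obj.map biprod.inl (φ.hom.app X x)) (by
    rw [← map_comp_app, ← hh, map_comp_app, hτ, map_zero])
  have e1 : T.obj.map c t = φ.hom.app X x := by
    have := congrArg (T.obj.map biprod.fst) ht
    rw [← map_comp_app, ← map_comp_app, biprod.lift_fst, biprod.inl_fst] at this
    simpa using this
  have e2 : T.obj.map f' t = 0 := by
    have := congrArg (T.obj.map biprod.snd) ht
    rw [← map_comp_app, ← map_comp_app, biprod.lift_snd, biprod.inl_snd] at this
    simpa using this
  obtain ⟨ψ, hψ⟩ := exists_hom_of_elt h1' (fun A g => (h2' A g).1) t e2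
  refine ⟨ObjectProperty.homMk ψ, ?_⟩
  ext A s
  obtain ⟨g, rfl⟩ := h1 A s
  change ψ.app A (i.hom.app A (F.obj.map g x)) = φ.hom.app A (F.obj.map g x)
  rw [nat_app, nat_app, nat_app, ← hc, nat_app, hψ, e1]⟩

end

/-! ### Right exactness of `- ⊗ L` and injectivity of `D_R (L,-)`. -/

section
variable {R : Type u} [Ring R]

open scoped TensorProduct

/-- The tensor product is right exact in its first variable. -/
lemma tensor_rightExact {X Q P : ModuleCat.{u} Rᵐᵒᵖ} {L : ModuleCat.{u} R} (j : X ⟶ Q) (q : Q ⟶ P)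
    (hq : Function.Surjective q) (hker : ∀ y, q y = 0 → ∃ x, j x = y)
    (z : tensorObj Q L) (hz : tensorMap q (𝟙 L) z = 0) : ∃ x, tensorMap j (𝟙 L) x = z := by
  let B : AddSubgroup (tensorObj Q L) := (tensorMap j (𝟙 L)).hom.range
  let k : tensorObj Q L →+ tensorObj Q L ⧸ B := QuotientAddGroup.mk' B
  -- The aim is a map `Φ` from `P ⊗ L` to `(Q ⊗ L) / B` through which `k` factors, so that the
  -- kernel of `q ⊗ L` lies in `B`. Lifts along `q` are chosen arbitrarily; modulo `B` the choice
  -- does not matter.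
  have wd (y y' : Q) (l : L) (h : q y = q y') : k (tmul y l) = k (tmul y' l) := by
    obtain ⟨x, hx⟩ := hker (y - y') (by rw [map_sub, h, sub_self])
    have e : y = y' + j x := by rw [hx]; abel
    have h0 : k (tmul (j x) l) = 0 := (QuotientAddGroup.eq_zero_iff _).2 ⟨tmul x l, rfl⟩
    rw [e, add_tmul, map_add, h0, add_zero]
  choose σ hσ using hq
  let Φ₀ : P →+ L →+ tensorObj Q L ⧸ B := AddMonoidHom.mk' (fun p =>
      AddMonoidHom.mk' (fun l => k (tmul (σ p) l)) (fun l l' => by rw [tmul_add, map_add]))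
      (fun p p' => by
        ext l
        change k _ = k _ + k _
        rw [wd (σ (p + p')) (σ p + σ p') l (by rw [map_add, hσ, hσ, hσ]), add_tmul, map_add])
  have hΦ₀ (y : Q) (l : L) : Φ₀ (q y) l = k (tmul y l) := wd _ _ l (hσ _)
  let Φ₁ : P ⊗[ℤ] L →+ tensorObj Q L ⧸ B := TensorProduct.liftAddHom Φ₀ (fun z x l => by simp)
  let Φ : tensorObj P L →+ tensorObj Q L ⧸ B := QuotientAddGroup.lift (balanced P L) Φ₁ (by
    rw [balanced, AddSubgroup.closure_le]
    rintro _ ⟨p, s, l, rfl⟩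
    change Φ₁ _ = 0
    rw [map_sub, sub_eq_zero]
    change Φ₀ (MulOpposite.op s • p) l = Φ₀ p (s • l)
    rw [← hσ p, ← map_smul, hΦ₀, hΦ₀, tmul_smul])
  have hΦ (z : tensorObj Q L) : Φ (tensorMap q (𝟙 L) z) = k z := by
    induction z using tensor_ind with
    | h y l => exact hΦ₀ y l
    | h0 => rw [map_zero, map_zero, map_zero]
    | hadd x y hx hy => rw [map_add, map_add, map_add, hx, hy]
  have := hΦ z
  rw [hz, map_zero] at this
  exact (QuotientAddGroup.eq_zero_iff _).1 this.symm

/-- The representable functor `(L, -)` in `(mod(Rᵒᵖ), Ab)`. -/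
abbrev repFP (L : FPMod R) : FPModAb R := AdditiveFunctor.of (preadditiveCoyoneda.obj (op L))

/-- The Yoneda lemma: the morphism `(L, -) ⟶ G` of an element of `G L`. -/
def repFPHom (G : FPModAb R) {L : FPMod R} (x : G.obj.obj L) : repFP L ⟶ G := ObjectProperty.homMk
  { app A := AddCommGrpCat.ofHom
      (AddMonoidHom.mk' (fun g : L ⟶ A => G.obj.map g x) (fun (g h : L ⟶ A) => by
        exact ConcreteCategory.congr_hom (G.obj.map_add (f := g) (g := h)) x))
    naturality A B h := by ext (g : L ⟶ A); exact map_comp_app G.obj g h x }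

lemma repFPHom_app (G : FPModAb R) {L A : FPMod R} (x : G.obj.obj L) (g : L ⟶ A) :
    (repFPHom G x).hom.app A g = G.obj.map g x := rfl

lemma repFPHom_app_id (G : FPModAb R) {L : FPMod R} (x : G.obj.obj L) :
    (repFPHom G x).hom.app L (𝟙 L) = x := by
  rw [repFPHom_app, G.obj.map_id]; rfl

lemma repFP_hom_ext {G : FPModAb R} {L : FPMod R} {a b : repFP L ⟶ G}
    (h : a.hom.app L (𝟙 L) = b.hom.app L (𝟙 L)) : a = b := by
  ext A (g : L ⟶ A)
  have e (c : repFP L ⟶ G) : c.hom.app A g = G.obj.map g (c.hom.app L (𝟙 L)) := by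
    refine Eq.trans ?_ (nat_app c.hom g (𝟙 L))
    change c.hom.app A g = c.hom.app A (𝟙 L ≫ g)
    rw [Category.id_comp]
  rw [e a, e b, h]

lemma DRObj_map_symm (G : FPModAb R) {M N : ModuleCat.{u} Rᵐᵒᵖ} (f : M ⟶ N) (x : (DRObj G).obj M) :
    (equivShrink (G ⟶ (tensorEmbedding R).obj N)).symm ((DRObj G).map f x) =
      (equivShrink (G ⟶ (tensorEmbedding R).obj M)).symm x ≫ (tensorEmbedding R).map f :=
  Equiv.symm_apply_apply _ _

/-- Evaluation at `𝟙 L` identifies `(D_R (L,-))(M)` with `M ⊗ L`, which is right exact in `M`. -/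
instance injective_DR_repFP (L : FPMod R) : Injective ((DR R).obj (op (repFP L))) :=
  injective_of_rightExact _ fun {X Y} j y hy => by
    change (DRObj (repFP L)).obj Y at y
    have hy' := (DRObj_map_symm (repFP L) (cokernel.π j) y).symm.trans
      ((congrArg _ hy).trans equivShrink_symm_zero)
    obtain ⟨x, hx⟩ := tensor_rightExact j (cokernel.π j)
      ((ModuleCat.epi_iff_surjective _).1 inferInstance)
      ((ShortComplex.moduleCat_exact_iff _).1 (ShortComplex.exact_cokernel j))
      (((equivShrink (repFP L ⟶ (tensorEmbedding R).obj Y)).symm y).hom.app L (𝟙 L))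
      (ConcreteCategory.congr_hom (NatTrans.congr_app (congrArg (fun a => a.hom) hy') L) (𝟙 L))
    refine ⟨equivShrink _ (repFPHom ((tensorEmbedding R).obj X) x), ?_⟩
    refine (equivShrink (repFP L ⟶ (tensorEmbedding R).obj Y)).symm.injective ?_
    refine (DRObj_map_symm _ _ _).trans (repFP_hom_ext ?_)
    rw [Equiv.symm_apply_apply]
    refine Eq.trans ?_ hx
    exact congrArg (tensorMap j (𝟙 L.obj)) (repFPHom_app_id ((tensorEmbedding R).obj X) x)

/-! ### Left adjoints of `D_R` preserve monomorphisms. -/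

/-- A left adjoint of `D_R` preserves monomorphisms. -/
lemma preservesMonomorphisms_of_adj {E : (IsFinPres (ModuleCat.{u} Rᵐᵒᵖ)).FullSubcategory ⥤ (FPModAb R)ᵒᵖ}
    (adj : E ⊣ DR R) : E.PreservesMonomorphisms := ⟨by
  intro F G i hi
  have : Epi (E.map i).unop := by
    have : Epi (E.map i).unop.hom := by
      have (L : FPMod R) : Epi ((E.map i).unop.hom.app L) := by
        refine (AddCommGrpCat.epi_iff_surjective _).2 fun s => ?_
        -- The element `s` is a map out of `(L,-)`, hence by adjunction a map `a` into the injective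
        -- `D_R (L,-)`. Extending `a` along `i` and transposing back lifts `s`.
        let a : F ⟶ (DR R).obj (op (repFP L)) := adj.homEquiv _ _ (repFPHom _ s).op
        let b : E.obj G ⟶ op (repFP L) := (adj.homEquiv _ _).symm (Injective.factorThru a i)
        have hb : E.map i ≫ b = (repFPHom _ s).op := by
          rw [← adj.homEquiv_naturality_left_symm, Injective.comp_factorThru, Equiv.symm_apply_apply]
        have hb' : b.unop ≫ (E.map i).unop = repFPHom _ s := congrArg Quiver.Hom.unop hb
        refine ⟨b.unop.hom.app L (𝟙 L), ?_⟩
        have := repFPHom_app_id _ s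
        rw [← hb'] at this
        exact this
      exact NatTrans.epi_of_epi_app _
    exact Functor.epi_of_epi_map (AdditiveFunctor.forget _ _) this
  exact inferInstanceAs (Mono (E.map i).unop.op)⟩

/-! ### The left adjoint of `D_R` on representables, and its existence. -/

/-- `Nat((X, -), D_R G) ≅ Nat(G, X ⊗ -)`. -/
noncomputable def yonedaFPHomEquiv (X : ModuleCat.{u} Rᵐᵒᵖ) (G : (FPModAb R)ᵒᵖ) :
    (op ((tensorEmbedding R).obj X) ⟶ G) ≃ ((yonedaFP _).obj (op X) ⟶ (DR R).obj G) where
  toFun h :=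
    have := (isFinPres_DRObj G.unop).additive
    ObjectProperty.homMk (ofElt (DRObj G.unop) (equivShrink _ h.unop))
  invFun a := ((equivShrink (G.unop ⟶ (tensorEmbedding R).obj X)).symm (a.hom.app X (𝟙 X))).op
  left_inv h := by
    refine Quiver.Hom.unop_inj ?_
    refine (Equiv.symm_apply_eq _).2 ?_
    exact ConcreteCategory.congr_hom ((DRObj G.unop).map_id X) _
  right_inv a := by
    ext A (g : X ⟶ A)
    refine Eq.trans ?_ (app_eq (X := X) a.hom g).symm
    exact congrArg ((DRObj G.unop).map g) (Equiv.apply_symm_apply _ _)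

lemma yonedaFPHomEquiv_app {X A : ModuleCat.{u} Rᵐᵒᵖ} {G : (FPModAb R)ᵒᵖ}
    (h : op ((tensorEmbedding R).obj X) ⟶ G) (g : X ⟶ A) :
    (yonedaFPHomEquiv X G h).hom.app A g =
      equivShrink (G.unop ⟶ (tensorEmbedding R).obj A) (h.unop ≫ (tensorEmbedding R).map g) :=
  congrArg (fun a => equivShrink (G.unop ⟶ (tensorEmbedding R).obj A) (a ≫ (tensorEmbedding R).map g))
    (Equiv.symm_apply_apply _ h.unop)

lemma DR_map_app {G G' : (FPModAb R)ᵒᵖ} (k : G ⟶ G') {A : ModuleCat.{u} Rᵐᵒᵖ}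
    (x : G.unop ⟶ (tensorEmbedding R).obj A) :
    ((DR R).map k).hom.app A (equivShrink (G.unop ⟶ (tensorEmbedding R).obj A) x) =
      equivShrink (G'.unop ⟶ (tensorEmbedding R).obj A) (k.unop ≫ x) :=
  congrArg (fun a => equivShrink (G'.unop ⟶ (tensorEmbedding R).obj A) (k.unop ≫ a))
    (Equiv.symm_apply_apply _ x)

lemma yonedaFPHomEquiv_comp {X : ModuleCat.{u} Rᵐᵒᵖ} {G G' : (FPModAb R)ᵒᵖ} (k : G ⟶ G')
    (h : op ((tensorEmbedding R).obj X) ⟶ G) :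
    yonedaFPHomEquiv X G' (h ≫ k) = yonedaFPHomEquiv X G h ≫ (DR R).map k := by
  ext A (g : X ⟶ A)
  refine (yonedaFPHomEquiv_app _ g).trans ?_
  refine Eq.trans ?_ (congrArg (((DR R).map k).hom.app A) (yonedaFPHomEquiv_app h g)).symm
  rw [DR_map_app, unop_comp, Category.assoc]

/-- Together with `yonedaFPHomEquiv_comp`, this makes `yonedaToDR` natural. -/
lemma yonedaFP_map_comp_yonedaFPHomEquiv {X Y : ModuleCat.{u} Rᵐᵒᵖ} (f : Y ⟶ X) {G : (FPModAb R)ᵒᵖ}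
    (h : op ((tensorEmbedding R).obj Y) ⟶ G) :
    (yonedaFP _).map f.op ≫ yonedaFPHomEquiv Y G h =
      yonedaFPHomEquiv X G (((tensorEmbedding R).map f).op ≫ h) := by
  ext A (g : X ⟶ A)
  refine (yonedaFPHomEquiv_app h (f ≫ g)).trans ?_
  refine Eq.trans ?_ (yonedaFPHomEquiv_app _ g).symm
  rw [Functor.map_comp, unop_comp, Category.assoc]
  rfl

/-- `D_R` is represented on `(X, -)` by `X ⊗ -`. -/
noncomputable def corepresentableByTensor (X : ModuleCat.{u} Rᵐᵒᵖ) :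
    (DR R ⋙ coyoneda.obj (op ((yonedaFP _).obj (op X)))).CorepresentableBy
      (op ((tensorEmbedding R).obj X)) where
  homEquiv := yonedaFPHomEquiv X _
  homEquiv_comp k h := yonedaFPHomEquiv_comp k h

instance : (DR R).IsRightAdjoint := by
  refine Functor.isRightAdjoint_of_leftAdjointObjIsDefined_eq_top ?_
  ext F
  simp only [Pi.top_apply, Prop.top_eq_true, iff_true]
  exact leftAdjointObjIsDefined_of_yonedaFP
    (fun X => (corepresentableByTensor X.unop).isCorepresentable) F

/-! ### Identification of the left adjoint of `D_R` with `D_A`. -/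

variable (R) in
/-- The comparison `(X, -) ⟶ D_R (X ⊗ -)`. -/
noncomputable def yonedaToDR : yonedaFP (ModuleCat.{u} Rᵐᵒᵖ) ⟶ (tensorEmbedding R).op ⋙ DR R where
  app X := yonedaFPHomEquiv X.unop _ (𝟙 _)
  naturality X Y f := by
    refine (yonedaFP_map_comp_yonedaFPHomEquiv f.unop (𝟙 _)).trans
      (Eq.trans ?_ (yonedaFPHomEquiv_comp _ _))
    rw [Category.comp_id, Category.id_comp]
    rfl

instance : (yonedaFP (ModuleCat.{u} Rᵐᵒᵖ)).Full := inferInstanceAs ((IsFinPres _).lift _ _).Full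
instance : (yonedaFP (ModuleCat.{u} Rᵐᵒᵖ)).Faithful :=
  inferInstanceAs ((IsFinPres _).lift _ _).Faithful

variable (R) in
/-- The comparison of the left adjoint of `D_R` with `t ∘ w`. -/
noncomputable def leftAdjointDRComparison :
    (DR R).leftAdjoint ⟶ wFunctor (ModuleCat.{u} Rᵐᵒᵖ) ⋙ (tensorEmbedding R).op :=
  leftAdjointComparison (Adjunction.ofIsRightAdjoint (yonedaFP (ModuleCat.{u} Rᵐᵒᵖ)))
    (Adjunction.ofIsRightAdjoint (DR R)) (yonedaToDR R)

/-- Composition with `yonedaToDR` at `X` is the bijection `yonedaFPHomEquiv`, since that component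
is the image of the identity. -/
lemma isIso_leftAdjointDRComparison_yonedaFP (X : (ModuleCat.{u} Rᵐᵒᵖ)ᵒᵖ) :
    IsIso ((leftAdjointDRComparison R).app ((yonedaFP _).obj X)) := by
  refine isIso_leftAdjointComparison_app _ _ _ X fun Z => ?_
  refine (congrArg Function.Bijective (funext fun g => ?_)).mpr (yonedaFPHomEquiv X.unop Z).bijective
  refine (yonedaFPHomEquiv_comp g (𝟙 _)).symm.trans ?_
  rw [Category.id_comp]

/-- A projective is a retract of any representable that maps onto it. -/
lemma isIso_leftAdjointDRComparison (F : (IsFinPres (ModuleCat.{u} Rᵐᵒᵖ)).FullSubcategory)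
    [Projective F] : IsIso ((leftAdjointDRComparison R).app F) := by
  obtain ⟨X, p, hp⟩ := exists_epi_yonedaFP F
  have := isIso_leftAdjointDRComparison_yonedaFP (R := R) (op X)
  exact isIso_app_of_retract _ ⟨Projective.factorThru (𝟙 F) p, p, Projective.factorThru_comp _ _⟩

variable (R) in
/-- `D_A` is the left adjoint of `D_R`. -/
noncomputable def DAIso : DA R ≅ (DR R).leftAdjoint := by
  let adj := Adjunction.ofIsRightAdjoint (DR R)
  have : PreservesFiniteColimits (DR R).leftAdjoint := 
    have := adj.leftAdjoint_preservesColimits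
    inferInstance
  -- Right exactness into the opposite category becomes left exactness of the contravariant functor,
  -- and projectives become injectives; this is the form required by `rightDerivedZeroIso`.
  have : PreservesFiniteLimits (DR R).leftAdjoint.leftOp := preservesFiniteLimits_leftOp _
  have : (DR R).leftAdjoint.leftOp.Additive := Functor.additive_of_preserves_binary_products _
  let α : (wFunctor (ModuleCat.{u} Rᵐᵒᵖ)).leftOp ⋙ tensorEmbedding R ⟶ (DR R).leftAdjoint.leftOp :=
    NatTrans.leftOp (leftAdjointDRComparison R)
  have hα (F : (IsFinPres (ModuleCat.{u} Rᵐᵒᵖ)).FullSubcategoryᵒᵖ) [Injective F] :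
      IsIso (α.app F) := by
    have : Projective F.unop := inferInstance
    have := isIso_leftAdjointDRComparison F.unop
    exact inferInstanceAs (IsIso ((leftAdjointDRComparison R).app F.unop).unop)
  exact NatIso.ofComponents (fun F => ((rightDerivedZeroIso α hα).app (op F)).symm.op)
    fun f => Quiver.Hom.unop_inj ((rightDerivedZeroIso α hα).inv.naturality f.op).symm

end
end AGJ

theorem mainTheorem8 (R : Type u) [Ring R] :
    Nonempty (AGJ.DA R ⊣ AGJ.DR R) ∧
    ∀ adj : AGJ.DA R ⊣ AGJ.DR R,
      ∃ h : ∀ F, AGJ.kernelProp (AGJ.DA R) ((AGJ.kernelFunctor adj.unit).obj F),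
        Nonempty ((AGJ.kernelProp (AGJ.DA R)).ι ⊣
          (AGJ.kernelProp (AGJ.DA R)).lift (AGJ.kernelFunctor adj.unit) h) := by
  refine ⟨⟨(Adjunction.ofIsRightAdjoint (AGJ.DR R)).ofNatIsoLeft (AGJ.DAIso R).symm⟩, fun adj => ?_⟩
  -- Only the adjunction itself enters here, so an arbitrary `adj` is covered, not just the one
  -- constructed above.
  have := AGJ.preservesMonomorphisms_of_adj adj
  exact ⟨AGJ.kernelProp_kernelFunctor_unit adj, ⟨AGJ.kernelCoreflection adj _⟩⟩
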